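/- Let $m>d\ge 0$ and let $A=(A_1,\dots,A_m)$ be a tuple of vectors in $\mathbb R^d$. For $I\subset[m]=\{1,\dots,m\}$ let $\mathrm{conv}\,A(I)$ be the convex hull of $\{A_i\}_{i\in I}$. Assume that $A$ is admissible, i.e. $0\in\mathrm{conv}\,A([m])$, and $|I|>d$ whenever $0\in\mathrm{conv}\,A(I)$; and that $A$ is centered at the origin, i.e. $\sum_{i=1}^m A_i=0$. For $z\in\mathbb C^m$ and $T\in\mathbb R^d$ put $F(z,T)=(z_ie^{\langle A_i,T\rangle})_{i=1}^m$ and $L_z=\{F(z,T)\mid T\in\mathbb R^d\}$ (the leaf of $z$), and let $\mathcal S_A=\{z\in\mathbb C^m\mid 0\in\mathrm{conv}\,A(\{i\mid z_i\ne 0\})\}$. Let $K_A=\{\sigma\subset[m]\mid 0\in\mathrm{conv}\,A([m]\setminus\sigma)\}$, and let $$(D^2,S^1)^{K_A}=\bigcup_{\sigma\in K_A}\{y\in\mathbb C^m\mid |y_i|\le 1\text{ for } i\in\sigma,\ |y_i|=1\text{ for } i\notin\sigma\}.$$ Fix $z\in\mathcal S_A$. For real $p\ge 1$ the leaf $L_z$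 contains a unique point $f_p(z)$ of least $L^p$-norm $\|w\|_p=(\sum_i|w_i|^p)^{1/p}$; this least norm is positive, and there is a unique $T_p(z)\in\mathbb R^d$ with $f_p(z)=F(z,T_p(z))$. The map $$\Phi_A(\infty)\colon (D^2,S^1)^{K_A}\times\mathbb R^d\times\mathbb R_{>0}\to\mathcal S_A,\qquad (x,T,r)\mapsto rF(x,T),$$ is a bijection; let $-T_\infty(z)$ be the $\mathbb R^d$-component of $\Phi_A(\infty)^{-1}(z)$. There is a unique point $f_\infty(z)\in L_z$ with $f_\infty(z)/\|f_\infty(z)\|_\infty\in(D^2,S^1)^{K_A}$; it is $f_\infty(z)=F(z,T_\infty(z))$, and $f_\infty(z)/\|f_\infty(z)\|_\infty$ is the unique point of $(D^2,S^1)^{K_A}$ that is a positive multiple of a point of $L_z$. Moreover $$\lim_{p\to\infty}T_p(z)=T_\infty(z)\qquad\text{and}\qquad \lim_{p\to\infty}\frac{f_p(z)}{\|f_p(z)\|_p}=\frac{f_\infty(z)}{\|f_\infty(z)\|_\infty}.$$ -/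

import Mathlib

open Set Filter Topology

namespace SiegelLeaves

noncomputable section

/-- `m`-tuples `A = (A_1, …, A_m)` of vectors of `ℝ^d`. -/
abbrev Config (d m : ℕ) := Fin m → EuclideanSpace ℝ (Fin d)

variable {d m : ℕ}

/-- `conv A(I)`: the convex hull of the vectors of `A` with index in `I`. -/
def convOn (A : Config d m) (I : Finset (Fin m)) : Set (EuclideanSpace ℝ (Fin d)) :=
  convexHull ℝ (A '' (I : Set (Fin m)))

/-- Admissibility: the Siegel condition together with the weak hyperbolicity condition.
The two conditions force `d < m`. -/
structure Admissible (A : Config d m) : Prop where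
  siegel : (0 : EuclideanSpace ℝ (Fin d)) ∈ convexHull ℝ (range A)
  weakHyperbolic : ∀ I : Finset (Fin m),
    (0 : EuclideanSpace ℝ (Fin d)) ∈ convOn A I → d < I.card

/-- The centroid of the vectors of `A` is the origin. -/
def CenteredAtOrigin (A : Config d m) : Prop := ∑ i, A i = 0

/-- The action `F(z, T) = (z_i e^{⟨A_i, T⟩})_i` of `ℝ^d` on `ℂ^m`. -/
def flow (A : Config d m) (z : Fin m → ℂ) (T : EuclideanSpace ℝ (Fin d)) : Fin m → ℂ :=
  fun i => z i * ((Real.exp (inner ℝ (A i) T) : ℝ) : ℂ)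

/-- The leaf `L_z` through `z`. -/
def leaf (A : Config d m) (z : Fin m → ℂ) : Set (Fin m → ℂ) := range (flow A z)

/-- The support `I_z` of `z`. -/
def supp (z : Fin m → ℂ) : Finset (Fin m) := Finset.univ.filter fun i => z i ≠ 0

/-- The union `S_A` of the Siegel leaves. -/
def siegelSet (A : Config d m) : Set (Fin m → ℂ) :=
  {z | (0 : EuclideanSpace ℝ (Fin d)) ∈ convOn A (supp z)}

/-- The `L^p`-norm on `ℂ^m` for real `p`. (The `L^∞`-norm is the norm of `Fin m → ℂ`.) -/
def pNorm (p : ℝ) (z : Fin m → ℂ) : ℝ := (∑ i, ‖z i‖ ^ p) ^ (1 / p)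

/-- `w` is a point of least `L^p`-norm in the leaf `L_z`. -/
def IsLeafMin (A : Config d m) (p : ℝ) (z w : Fin m → ℂ) : Prop :=
  w ∈ leaf A z ∧ ∀ v ∈ leaf A z, pNorm p w ≤ pNorm p v

/-- `f_p(z)`: the point of least `L^p`-norm in `L_z`. -/
def fMin (A : Config d m) (p : ℝ) (z : Fin m → ℂ) : Fin m → ℂ :=
  Classical.epsilon (IsLeafMin A p z)

/-- `T_p(z)`: the vector with `f_p(z) = F(z, T_p(z))`. -/
def TMin (A : Config d m) (p : ℝ) (z : Fin m → ℂ) : EuclideanSpace ℝ (Fin d) :=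
  Classical.epsilon fun T => fMin A p z = flow A z T

/-- The simplicial complex `K_A`. -/
def simplicialComplex (A : Config d m) : Set (Finset (Fin m)) :=
  {σ | (0 : EuclideanSpace ℝ (Fin d)) ∈ convOn A σᶜ}

/-- The moment-angle complex `(D², S¹)^{K_A}`. -/
def momentAngle (A : Config d m) : Set (Fin m → ℂ) :=
  ⋃ σ ∈ simplicialComplex A,
    Set.pi univ fun i => if i ∈ σ then Metric.closedBall (0 : ℂ) 1 else Metric.sphere (0 : ℂ) 1

/-- The map `(x, T, r) ↦ r F(x, T)`. -/
def Phi (A : Config d m) (q : (Fin m → ℂ) × EuclideanSpace ℝ (Fin d) × ℝ) : Fin m → ℂ :=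
  q.2.2 • flow A q.1 q.2.1

/-- The domain `(D², S¹)^{K_A} × ℝ^d × ℝ_{>0}` of `Φ_A(∞)`. -/
def phiInftyDomain (A : Config d m) : Set ((Fin m → ℂ) × EuclideanSpace ℝ (Fin d) × ℝ) :=
  momentAngle A ×ˢ (univ ×ˢ Ioi 0)

/-- The inverse of `Φ_A(∞)`. -/
def phiInftyInv (A : Config d m) :
    (Fin m → ℂ) → (Fin m → ℂ) × EuclideanSpace ℝ (Fin d) × ℝ :=
  Function.invFunOn (Phi A) (phiInftyDomain A)

/-- `T_∞(z)`, the `ℝ^d`-component of `Φ_A(∞)⁻¹(z)` up to sign. The inverse of `Φ_A(∞)` carries `z`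
to `(x, T, r)` with `z = r F(x, T)`, that is `x = r⁻¹ F(z, -T)`, whereas `T_p` moves `z`
to the minimum, `f_p(z) = F(z, T_p(z))`; the minus sign makes the two conventions agree. -/
def TInfty (A : Config d m) (z : Fin m → ℂ) : EuclideanSpace ℝ (Fin d) :=
  -(phiInftyInv A z).2.1

/-- `w` is a point of `L_z` with `w / ‖w‖_∞ ∈ (D², S¹)^{K_A}`. -/
def IsLeafInfty (A : Config d m) (z w : Fin m → ℂ) : Prop :=
  w ∈ leaf A z ∧ ‖w‖⁻¹ • w ∈ momentAngle A

/-- `f_∞(z)`: the point of `L_z` with `f_∞(z) / ‖f_∞(z)‖_∞ ∈ (D², S¹)^{K_A}`. -/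
def fInfty (A : Config d m) (z : Fin m → ℂ) : Fin m → ℂ :=
  Classical.epsilon (IsLeafInfty A z)

end

end SiegelLeaves

/-!
Everything rests on one consequence of weak hyperbolicity, `Admissible.eq_zero_of_inner_nonpos`:
if `0 ∈ conv A(J)`, a vector `v` with `⟨A_j, v⟩ ≤ 0` for all `j ∈ J` vanishes. Applied to the
support of a Siegel point `z`, it shows that `T ↦ F(z, T)` is injective and that `‖F(z, T)‖_∞` is
proper in `T` (`Admissible.isCompact_norm_flow_le`).

For finite `p` the function `T ↦ ‖F(z, T)‖_p ^ p` is a sum of exponentials. Properness gives a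
minimum, where the critical point equation `∑ i, |w_i| ^ p A_i = 0` holds for `w = F(z, T)`, and
this equation characterizes a unique strict minimum (`Admissible.pNorm_lt_pNorm_flow`).

For `p = ∞` a nonzero `w` satisfies `w / ‖w‖_∞ ∈ (D², S¹)^{K_A}` exactly when `0 ∈ conv A(I)`, with
`I` the set of coordinates of `w` of greatest modulus
(`inv_norm_smul_mem_momentAngle_iff`). Comparing two such points of one leaf and applying the key
fact to the larger one shows that they coincide
(`Admissible.eq_of_zero_mem_convOn_maxIndices`).

Existence of `f_∞(z)` and convergence come from the same compactness argument
(`Admissible.exists_subseq_tendsto`). The `T_p(z)`, `p ≥ 1`, stay in a compact set, and the critical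
point equation writes `0` as a convex combination of the `A_i` with weights proportional to
`|w_i| ^ p`. Along a convergent subsequence with `p → ∞` the weights of all coordinates not of
greatest modulus die out, so every limit point of `T_p(z)` is a parameter of `f_∞(z)`; by uniqueness
there is only one. Bijectivity of `Φ_A(∞)` restates existence and uniqueness of `f_∞`.
-/

namespace SiegelLeaves

variable {d m : ℕ} {A : Config d m} {z w : Fin m → ℂ} {I J : Finset (Fin m)} {p : ℝ}

/-! ### Convex hulls of subconfigurations -/

theorem convOn_mono (h : I ⊆ J) : convOn A I ⊆ convOn A J :=
  convexHull_mono (image_mono (Finset.coe_subset.2 h))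

theorem nonempty_of_zero_mem_convOn (h : (0 : EuclideanSpace ℝ (Fin d)) ∈ convOn A I) :
    I.Nonempty := by
  by_contra hI
  rw [Finset.not_nonempty_iff_eq_empty] at hI
  simp [convOn, hI] at h

theorem zero_mem_convOn_of_sum {c : Fin m → ℝ} (hc : ∀ i, 0 ≤ c i) (h1 : ∑ i, c i = 1)
    (h0 : ∑ i, c i • A i = 0) (hJ : ∀ i ∉ J, c i = 0) :
    (0 : EuclideanSpace ℝ (Fin d)) ∈ convOn A J := by
  have e1 : ∑ i ∈ J, c i = 1 := by
    rw [← h1]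
    exact Finset.sum_subset (Finset.subset_univ J) fun i _ hi => hJ i hi
  have e0 : ∑ i ∈ J, c i • A i = 0 := by
    rw [← h0]
    exact Finset.sum_subset (Finset.subset_univ J) fun i _ hi => by simp [hJ i hi]
  rw [← e0]
  exact (convex_convexHull ℝ _).sum_mem (fun i _ => hc i) e1
    fun i hi => subset_convexHull ℝ _ (mem_image_of_mem A hi)

/-- If `0 ∈ conv A(J)`, then no nonzero vector has nonpositive inner product with all of `A(J)`.
This is where weak hyperbolicity enters: by Carathéodory, `0` is a combination with positive
coefficients of affinely independent vectors from `A(J)`. These would all be orthogonal to such a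
vector `v`, and a hyperplane holds at most `d` affinely independent vectors. -/
theorem Admissible.eq_zero_of_inner_nonpos (hA : Admissible A)
    (hJ : (0 : EuclideanSpace ℝ (Fin d)) ∈ convOn A J) {v : EuclideanSpace ℝ (Fin d)}
    (hv : ∀ j ∈ J, inner ℝ (A j) v ≤ 0) : v = 0 := by
  classical
  obtain ⟨ι, _, a, c, hrange, hind, hcpos, hc1, hc0⟩ := eq_pos_convex_span_of_mem_convexHull hJ
  have hsel : ∀ k, ∃ j ∈ J, A j = a k := fun k => hrange (mem_range_self k)
  choose s hsJ hs using hsel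
  have hsum : ∑ k, c k * inner ℝ (a k) v = 0 := by
    have : inner ℝ (∑ k, c k • a k) v = 0 := by rw [hc0, inner_zero_left]
    simpa [sum_inner, real_inner_smul_left] using this
  have hterm : ∀ k, c k * inner ℝ (a k) v ≤ 0 := fun k =>
    mul_nonpos_of_nonneg_of_nonpos (hcpos k).le (hs k ▸ hv _ (hsJ k))
  have horth : ∀ k, inner ℝ (a k) v = 0 := fun k => by
    have := (Finset.sum_eq_zero_iff_of_nonpos fun k _ => hterm k).1 hsum k (Finset.mem_univ k)
    exact (mul_eq_zero.1 this).resolve_left (hcpos k).ne'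
  have hmem : (0 : EuclideanSpace ℝ (Fin d)) ∈ convOn A (Finset.univ.image s) := by
    rw [← hc0]
    exact (convex_convexHull ℝ _).sum_mem (fun k _ => (hcpos k).le) hc1 fun k _ =>
      subset_convexHull ℝ _ ⟨s k, by simp, hs k⟩
  have hcard : d < Fintype.card ι :=
    (hA.weakHyperbolic _ hmem).trans_le (Finset.card_image_le.trans_eq Finset.card_univ)
  have : Nonempty ι := Fintype.card_pos_iff.1 (Nat.zero_lt_of_lt hcard)
  by_contra hv0
  have hspan : vectorSpan ℝ (range a) ≤ (ℝ ∙ v)ᗮ := by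
    rw [vectorSpan_def, Submodule.span_le]
    rintro _ ⟨_, ⟨k, rfl⟩, _, ⟨l, rfl⟩, rfl⟩
    rw [SetLike.mem_coe, Submodule.mem_orthogonal_singleton_iff_inner_left]
    simp [inner_sub_left, horth]
  have hne : vectorSpan ℝ (range a) ≠ ⊤ := fun h => by
    have : v ∈ (ℝ ∙ v)ᗮ := hspan (h ▸ Submodule.mem_top)
    rw [Submodule.mem_orthogonal_singleton_iff_inner_left] at this
    exact hv0 (inner_self_eq_zero.1 this)
  have h1 := Submodule.finrank_lt hne
  have h2 := hind.finrank_vectorSpan_add_one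
  rw [finrank_euclideanSpace_fin] at h1
  omega

/-- By compactness of the unit sphere, `T ↦ max_{i ∈ I} ⟨A_i, T⟩` grows at least linearly
when `0 ∈ conv A(I)`. -/
theorem Admissible.exists_mul_norm_le_inner (hA : Admissible A)
    (hI : (0 : EuclideanSpace ℝ (Fin d)) ∈ convOn A I) :
    ∃ ε > 0, ∀ T, ∃ i ∈ I, ε * ‖T‖ ≤ inner ℝ (A i) T := by
  have hne := nonempty_of_zero_mem_convOn hI
  set φ : EuclideanSpace ℝ (Fin d) → ℝ := fun T => I.sup' hne fun i => inner ℝ (A i) T with hφ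
  have hcont : Continuous φ := Continuous.finset_sup'_apply hne fun i _ => by fun_prop
  rcases (Metric.sphere (0 : EuclideanSpace ℝ (Fin d)) 1).eq_empty_or_nonempty with hs | hs
  · have hzero : ∀ T : EuclideanSpace ℝ (Fin d), T = 0 := fun T => by
      by_contra hT
      have : ‖T‖⁻¹ • T ∈ Metric.sphere (0 : EuclideanSpace ℝ (Fin d)) 1 := by
        simp [norm_smul, hT]
      rw [hs] at this
      exact this
    obtain ⟨i, hi⟩ := hne
    exact ⟨1, one_pos, fun T => ⟨i, hi, by simp [hzero T]⟩⟩
  · obtain ⟨v, hv, hmin⟩ := (isCompact_sphere _ _).exists_isMinOn hs hcont.continuousOn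
    have hpos : 0 < φ v := by
      by_contra hle
      have : v = 0 := hA.eq_zero_of_inner_nonpos hI fun j hj =>
        (Finset.le_sup' (fun i => inner ℝ (A i) v) hj).trans (not_lt.1 hle)
      simp [this] at hv
    refine ⟨φ v, hpos, fun T => ?_⟩
    by_cases hT : T = 0
    · obtain ⟨i, hi⟩ := hne
      exact ⟨i, hi, by simp [hT]⟩
    have hT' : 0 < ‖T‖ := norm_pos_iff.2 hT
    have hmem : ‖T‖⁻¹ • T ∈ Metric.sphere (0 : EuclideanSpace ℝ (Fin d)) 1 := by
      simp [norm_smul, hT]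
    obtain ⟨i, hi, hmax⟩ := Finset.exists_mem_eq_sup' hne fun i => inner ℝ (A i) (‖T‖⁻¹ • T)
    have hle : φ v ≤ inner ℝ (A i) (‖T‖⁻¹ • T) := hmax ▸ hmin hmem
    refine ⟨i, hi, ?_⟩
    rw [real_inner_smul_right, inv_mul_eq_div, le_div_iff₀ hT'] at hle
    exact hle

/-! ### The flow and its leaves -/

@[simp] theorem mem_supp {i : Fin m} : i ∈ supp z ↔ z i ≠ 0 := by simp [supp]

theorem norm_flow_apply (A : Config d m) (z : Fin m → ℂ) (T : EuclideanSpace ℝ (Fin d))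
    (i : Fin m) : ‖flow A z T i‖ = ‖z i‖ * Real.exp (inner ℝ (A i) T) := by
  rw [flow, norm_mul, Complex.norm_real, Real.norm_of_nonneg (Real.exp_pos _).le]

@[simp] theorem flow_zero (A : Config d m) (z : Fin m → ℂ) : flow A z 0 = z := by
  funext i; simp [flow]

theorem flow_flow (A : Config d m) (z : Fin m → ℂ) (S T : EuclideanSpace ℝ (Fin d)) :
    flow A (flow A z S) T = flow A z (S + T) := by
  funext i
  simp only [flow, inner_add_right, Real.exp_add, Complex.ofReal_mul]
  ring

theorem flow_smul (A : Config d m) (r : ℝ) (z : Fin m → ℂ) (T : EuclideanSpace ℝ (Fin d)) :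
    flow A (r • z) T = r • flow A z T := by
  funext i
  simp only [flow, Pi.smul_apply, smul_mul_assoc]

@[simp] theorem supp_flow (A : Config d m) (z : Fin m → ℂ) (T : EuclideanSpace ℝ (Fin d)) :
    supp (flow A z T) = supp z := by
  ext i
  simp [flow]

theorem supp_smul {r : ℝ} (hr : r ≠ 0) (z : Fin m → ℂ) : supp (r • z) = supp z := by
  ext i
  simp [hr]

theorem continuous_flow (A : Config d m) (z : Fin m → ℂ) : Continuous (flow A z) := by
  unfold flow
  fun_prop

theorem mem_leaf (A : Config d m) (z : Fin m → ℂ) : z ∈ leaf A z := ⟨0, flow_zero A z⟩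

theorem ne_zero_of_mem_siegelSet (hz : z ∈ siegelSet A) : z ≠ 0 := by
  rintro rfl
  obtain ⟨i, hi⟩ := nonempty_of_zero_mem_convOn hz
  simp at hi

theorem flow_mem_siegelSet (hz : z ∈ siegelSet A) (T : EuclideanSpace ℝ (Fin d)) :
    flow A z T ∈ siegelSet A := by
  rwa [siegelSet, mem_ofPred_eq, supp_flow]

theorem norm_flow_pos (hz : z ∈ siegelSet A) (T : EuclideanSpace ℝ (Fin d)) :
    0 < ‖flow A z T‖ :=
  norm_pos_iff.2 (ne_zero_of_mem_siegelSet (flow_mem_siegelSet hz T))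

theorem Admissible.flow_injective (hA : Admissible A) (hz : z ∈ siegelSet A) :
    Function.Injective (flow A z) := by
  intro S T h
  refine sub_eq_zero.1 (hA.eq_zero_of_inner_nonpos hz fun i hi => le_of_eq ?_)
  have hi' : 0 < ‖z i‖ := norm_pos_iff.2 (mem_supp.1 hi)
  have := congrArg (fun w => ‖w i‖) h
  simp only [norm_flow_apply] at this
  rw [inner_sub_right, sub_eq_zero]
  exact Real.exp_injective (mul_left_cancel₀ hi'.ne' this)

/-- On a Siegel leaf the sup norm is a proper function of the parameter `T`. -/
theorem Admissible.isCompact_norm_flow_le (hA : Admissible A) (hz : z ∈ siegelSet A) (C : ℝ) :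
    IsCompact {T | ‖flow A z T‖ ≤ C} := by
  refine Metric.isCompact_of_isClosed_isBounded
    (isClosed_le (continuous_flow A z).norm continuous_const) ?_
  obtain ⟨ε, hε, h⟩ := hA.exists_mul_norm_le_inner hz
  refine (Metric.isBounded_closedBall (x := 0) (r := (∑ i, C / ‖z i‖) / ε)).subset fun T hT => ?_
  rw [mem_ofPred_eq] at hT
  obtain ⟨i, hi, hle⟩ := h T
  have hi' : 0 < ‖z i‖ := norm_pos_iff.2 (mem_supp.1 hi)
  have hC : 0 ≤ C := (norm_nonneg _).trans hT
  have h1 : ‖z i‖ * Real.exp (inner ℝ (A i) T) ≤ C :=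
    norm_flow_apply A z T i ▸ (norm_le_pi_norm _ i).trans hT
  rw [mem_closedBall_zero_iff, le_div_iff₀ hε]
  calc ‖T‖ * ε ≤ Real.exp (inner ℝ (A i) T) := by
        have := Real.add_one_le_exp (inner ℝ (A i) T)
        linarith
    _ ≤ C / ‖z i‖ := by rwa [le_div_iff₀ hi', mul_comm]
    _ ≤ ∑ i, C / ‖z i‖ :=
        Finset.single_le_sum (f := fun i => C / ‖z i‖) (fun _ _ => by positivity)
          (Finset.mem_univ i)

/-! ### The moment-angle complex -/

theorem mem_momentAngle_iff {y : Fin m → ℂ} : y ∈ momentAngle A ↔ (∀ i, ‖y i‖ ≤ 1) ∧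
    (0 : EuclideanSpace ℝ (Fin d)) ∈ convOn A (Finset.univ.filter fun i => ‖y i‖ = 1) := by
  simp only [momentAngle, mem_iUnion, exists_prop, simplicialComplex, mem_ofPred_eq, mem_univ_pi]
  constructor
  · rintro ⟨σ, hσ, hy⟩
    refine ⟨fun i => ?_, convOn_mono (fun i hi => ?_) hσ⟩
    · have := hy i
      split_ifs at this
      · simpa using this
      · exact (mem_sphere_zero_iff_norm.1 this).le
    · have := hy i
      rw [if_neg (Finset.mem_compl.1 hi)] at this
      simpa using this
  · rintro ⟨hle, h⟩
    refine ⟨(Finset.univ.filter fun i => ‖y i‖ = 1)ᶜ, by rwa [compl_compl], fun i => ?_⟩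
    split_ifs with hi
    · simpa using hle i
    · simpa using hi

theorem norm_eq_one_of_mem_momentAngle {y : Fin m → ℂ} (hy : y ∈ momentAngle A) : ‖y‖ = 1 := by
  obtain ⟨hle, h⟩ := mem_momentAngle_iff.1 hy
  obtain ⟨i, hi⟩ := nonempty_of_zero_mem_convOn h
  refine le_antisymm ((pi_norm_le_iff_of_nonneg zero_le_one).2 hle) ?_
  rw [← (Finset.mem_filter.1 hi).2]
  exact norm_le_pi_norm y i

theorem momentAngle_subset_siegelSet : momentAngle A ⊆ siegelSet A := fun y hy => by
  refine convOn_mono (fun i hi => ?_) (mem_momentAngle_iff.1 hy).2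
  have : ‖y i‖ = 1 := (Finset.mem_filter.1 hi).2
  rw [mem_supp, ← norm_pos_iff, this]
  exact one_pos

/-- The indices of the coordinates of `w` of greatest modulus. -/
noncomputable def maxIndices (w : Fin m → ℂ) : Finset (Fin m) :=
  Finset.univ.filter fun i => ‖w i‖ = ‖w‖

theorem inv_norm_smul_mem_momentAngle_iff (hw : w ≠ 0) : ‖w‖⁻¹ • w ∈ momentAngle A ↔
    (0 : EuclideanSpace ℝ (Fin d)) ∈ convOn A (maxIndices w) := by
  have hpos : 0 < ‖w‖ := norm_pos_iff.2 hw
  have h (i : Fin m) : ‖(‖w‖⁻¹ • w) i‖ = ‖w i‖ / ‖w‖ := by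
    rw [Pi.smul_apply, norm_smul, norm_inv, norm_norm, inv_mul_eq_div]
  simp only [mem_momentAngle_iff, h, div_le_one hpos, norm_le_pi_norm, implies_true, true_and,
    div_eq_one_iff_eq hpos.ne', maxIndices]

/-- `0 ∈ conv A(maxIndices w)` says that the convex function `T ↦ log ‖F(z, T)‖_∞` has `0` among
its subgradients at the given parameter; weak hyperbolicity makes that parameter unique. If the value at `S` is at
most that at `T`, then `S - T` has nonpositive inner product with all `A_j` for
`j ∈ maxIndices (F(z, T))`. -/
theorem Admissible.eq_of_zero_mem_convOn_maxIndices (hA : Admissible A) (hz : z ∈ siegelSet A)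
    {S T : EuclideanSpace ℝ (Fin d)}
    (hS : (0 : EuclideanSpace ℝ (Fin d)) ∈ convOn A (maxIndices (flow A z S)))
    (hT : (0 : EuclideanSpace ℝ (Fin d)) ∈ convOn A (maxIndices (flow A z T))) : S = T := by
  wlog hle : ‖flow A z S‖ ≤ ‖flow A z T‖ generalizing S T
  · exact (this hT hS (le_of_not_ge hle)).symm
  refine sub_eq_zero.1 (hA.eq_zero_of_inner_nonpos hT fun j hj => ?_)
  have hj : ‖flow A z T j‖ = ‖flow A z T‖ := (Finset.mem_filter.1 hj).2
  have hzj : 0 < ‖z j‖ := by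
    have hpos := norm_flow_pos hz T
    rw [← hj, norm_flow_apply] at hpos
    exact pos_of_mul_pos_left hpos (Real.exp_pos _).le
  have h : ‖flow A z S j‖ ≤ ‖flow A z T j‖ := (norm_le_pi_norm _ j).trans (hj ▸ hle)
  rw [norm_flow_apply, norm_flow_apply, mul_le_mul_iff_right₀ hzj, Real.exp_le_exp] at h
  rw [inner_sub_right]
  linarith

/-! ### The `L^p`-norms -/

theorem sum_norm_rpow_nonneg (p : ℝ) (w : Fin m → ℂ) : 0 ≤ ∑ i, ‖w i‖ ^ p :=
  Finset.sum_nonneg fun _ _ => Real.rpow_nonneg (norm_nonneg _) _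

theorem norm_le_pNorm (hp : 0 < p) (w : Fin m → ℂ) : ‖w‖ ≤ pNorm p w := by
  refine (pi_norm_le_iff_of_nonneg (Real.rpow_nonneg (sum_norm_rpow_nonneg p w) _)).2 fun i => ?_
  rw [one_div, Real.le_rpow_inv_iff_of_pos (norm_nonneg _) (sum_norm_rpow_nonneg p w) hp]
  exact Finset.single_le_sum (f := fun i => ‖w i‖ ^ p)
    (fun _ _ => Real.rpow_nonneg (norm_nonneg _) _) (Finset.mem_univ i)

theorem norm_rpow_le_sum (hp : 0 < p) (w : Fin m → ℂ) : ‖w‖ ^ p ≤ ∑ i, ‖w i‖ ^ p := by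
  have h := norm_le_pNorm hp w
  rwa [pNorm, one_div,
    Real.le_rpow_inv_iff_of_pos (norm_nonneg _) (sum_norm_rpow_nonneg p w) hp] at h

theorem pNorm_le (hp : 0 < p) (w : Fin m → ℂ) : pNorm p w ≤ (m : ℝ) ^ p⁻¹ * ‖w‖ := by
  have h : ∑ i, ‖w i‖ ^ p ≤ m * ‖w‖ ^ p := by
    refine (Finset.sum_le_card_nsmul _ _ (‖w‖ ^ p) fun i _ =>
      Real.rpow_le_rpow (norm_nonneg _) (norm_le_pi_norm w i) hp.le).trans_eq ?_
    simp
  calc pNorm p w ≤ (m * ‖w‖ ^ p) ^ (1 / p) :=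
        Real.rpow_le_rpow (sum_norm_rpow_nonneg p w) h (by positivity)
    _ = (m : ℝ) ^ p⁻¹ * ‖w‖ := by
        rw [one_div, Real.mul_rpow (by positivity) (by positivity),
          Real.rpow_rpow_inv (norm_nonneg _) hp.ne']

theorem continuous_pNorm (hp : 0 < p) : Continuous (pNorm p : (Fin m → ℂ) → ℝ) := by
  unfold pNorm
  refine Continuous.rpow_const (continuous_finsetSum _ fun i _ => ?_) fun _ => Or.inr (by positivity)
  exact Continuous.rpow_const (by fun_prop) fun _ => Or.inr hp.le

theorem norm_flow_apply_rpow (A : Config d m) (w : Fin m → ℂ) (T : EuclideanSpace ℝ (Fin d))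
    (p : ℝ) (i : Fin m) :
    ‖flow A w T i‖ ^ p = ‖w i‖ ^ p * Real.exp (p * inner ℝ (A i) T) := by
  rw [norm_flow_apply, Real.mul_rpow (norm_nonneg _) (Real.exp_pos _).le, ← Real.exp_mul, mul_comm p]

/-! ### The point of least `L^p`-norm in a leaf -/

theorem IsLeafMin.pNorm_le_flow (h : IsLeafMin A p z w) (T : EuclideanSpace ℝ (Fin d)) :
    pNorm p w ≤ pNorm p (flow A w T) := by
  obtain ⟨⟨S, rfl⟩, hmin⟩ := h
  exact hmin _ ⟨S + T, (flow_flow A z S T).symm⟩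

/-- The critical point equation of `T ↦ ‖F(w, T)‖_p ^ p` at a minimum. -/
theorem IsLeafMin.sum_rpow_smul_eq_zero (hp : 0 < p) (h : IsLeafMin A p z w) :
    ∑ i, ‖w i‖ ^ p • A i = 0 := by
  refine ext_inner_right ℝ fun v => ?_
  set g : ℝ → ℝ := fun s => ∑ i, ‖w i‖ ^ p * Real.exp (s * (p * inner ℝ (A i) v)) with hg
  have hgflow (s : ℝ) : g s = ∑ i, ‖flow A w (s • v) i‖ ^ p := by
    simp only [hg, norm_flow_apply_rpow, real_inner_smul_right]
    exact Finset.sum_congr rfl fun i _ => by ring_nf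
  have hmin : IsLocalMin g 0 := Eventually.of_forall fun s => by
    have := h.pNorm_le_flow (s • v)
    rw [pNorm, pNorm, Real.rpow_le_rpow_iff (sum_norm_rpow_nonneg p _) (sum_norm_rpow_nonneg p _)
      (by positivity)] at this
    rw [hgflow, hgflow]
    simpa using this
  have hderiv : HasDerivAt g (∑ i, ‖w i‖ ^ p * (p * inner ℝ (A i) v)) 0 := by
    refine HasDerivAt.fun_sum fun i _ => HasDerivAt.const_mul _ ?_
    simpa using ((hasDerivAt_id (0 : ℝ)).mul_const (p * inner ℝ (A i) v)).exp
  have h0 := hmin.hasDerivAt_eq_zero hderiv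
  rw [inner_zero_left, sum_inner]
  simp only [real_inner_smul_left]
  have : p * ∑ i, ‖w i‖ ^ p * inner ℝ (A i) v = 0 := by
    rw [← h0, Finset.mul_sum]
    exact Finset.sum_congr rfl fun i _ => by ring
  exact (mul_eq_zero.1 this).resolve_left hp.ne'

/-- A critical point is a strict global minimum, by strict convexity of the exponential in the
form `1 + x < exp x`. -/
theorem Admissible.pNorm_lt_pNorm_flow (hA : Admissible A) (hp : 0 < p) (hw : w ∈ siegelSet A)
    (hcrit : ∑ i, ‖w i‖ ^ p • A i = 0) {T : EuclideanSpace ℝ (Fin d)} (hT : T ≠ 0) :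
    pNorm p w < pNorm p (flow A w T) := by
  refine Real.rpow_lt_rpow (sum_norm_rpow_nonneg p w) ?_ (by positivity)
  have h0 : ∑ i, ‖w i‖ ^ p * (p * inner ℝ (A i) T) = 0 := by
    have : inner ℝ (∑ i, ‖w i‖ ^ p • A i) T = 0 := by rw [hcrit, inner_zero_left]
    rw [sum_inner] at this
    simp only [real_inner_smul_left] at this
    rw [← mul_zero p, ← this, Finset.mul_sum]
    exact Finset.sum_congr rfl fun i _ => by ring
  obtain ⟨i, hi, hpos⟩ : ∃ i ∈ supp w, 0 < inner ℝ (A i) T := by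
    by_contra! hle
    exact hT (hA.eq_zero_of_inner_nonpos hw hle)
  have h1 : ∑ i, ‖w i‖ ^ p = ∑ i, ‖w i‖ ^ p * (p * inner ℝ (A i) T + 1) := by
    simp only [mul_add, mul_one, Finset.sum_add_distrib, h0, zero_add]
  rw [h1]
  simp only [norm_flow_apply_rpow]
  refine Finset.sum_lt_sum (fun j _ => mul_le_mul_of_nonneg_left (Real.add_one_le_exp _)
    (Real.rpow_nonneg (norm_nonneg _) _)) ⟨i, Finset.mem_univ i, ?_⟩
  exact mul_lt_mul_of_pos_left (Real.add_one_lt_exp (mul_pos hp hpos).ne')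
    (Real.rpow_pos_of_pos (norm_pos_iff.2 (mem_supp.1 hi)) _)

theorem Admissible.existsUnique_isLeafMin (hA : Admissible A) (hp : 0 < p)
    (hz : z ∈ siegelSet A) : ∃! w, IsLeafMin A p z w := by
  have hK := hA.isCompact_norm_flow_le hz (pNorm p z)
  have h0 : (0 : EuclideanSpace ℝ (Fin d)) ∈ {T | ‖flow A z T‖ ≤ pNorm p z} := by
    simpa using norm_le_pNorm hp z
  obtain ⟨S, hS, hmin⟩ := hK.exists_isMinOn ⟨0, h0⟩
    ((continuous_pNorm hp).comp (continuous_flow A z)).continuousOn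
  have hSmin : IsLeafMin A p z (flow A z S) := by
    refine ⟨⟨S, rfl⟩, ?_⟩
    rintro _ ⟨T, rfl⟩
    by_cases hT : ‖flow A z T‖ ≤ pNorm p z
    · exact hmin hT
    · calc pNorm p (flow A z S) ≤ pNorm p (flow A z 0) := hmin h0
        _ = pNorm p z := by rw [flow_zero]
        _ ≤ ‖flow A z T‖ := (not_le.1 hT).le
        _ ≤ pNorm p (flow A z T) := norm_le_pNorm hp _
  refine ⟨_, hSmin, ?_⟩
  intro w hw
  obtain ⟨T, rfl⟩ := hw.1
  by_contra hne
  have hTS : T - S ≠ 0 := fun h => hne (by rw [sub_eq_zero.1 h])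
  have hlt := hA.pNorm_lt_pNorm_flow hp (flow_mem_siegelSet hz S)
    (hSmin.sum_rpow_smul_eq_zero hp) hTS
  rw [flow_flow, add_sub_cancel] at hlt
  exact absurd (hw.2 _ ⟨S, rfl⟩) (not_le.2 hlt)

theorem Admissible.isLeafMin_fMin (hA : Admissible A) (hp : 0 < p) (hz : z ∈ siegelSet A) :
    IsLeafMin A p z (fMin A p z) :=
  Classical.epsilon_spec (hA.existsUnique_isLeafMin hp hz).exists

theorem Admissible.fMin_eq_flow (hA : Admissible A) (hp : 0 < p) (hz : z ∈ siegelSet A) :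
    fMin A p z = flow A z (TMin A p z) := by
  obtain ⟨T, hT⟩ := (hA.isLeafMin_fMin hp hz).1
  exact Classical.epsilon_spec (p := fun T => fMin A p z = flow A z T) ⟨T, hT.symm⟩

theorem Admissible.pNorm_fMin_pos (hA : Admissible A) (hp : 0 < p) (hz : z ∈ siegelSet A) :
    0 < pNorm p (fMin A p z) := by
  rw [hA.fMin_eq_flow hp hz]
  exact (norm_flow_pos hz _).trans_le (norm_le_pNorm hp _)

/-- The sup norm of `f_p(z)` is bounded uniformly in `p ≥ 1`. -/
theorem Admissible.norm_fMin_le (hA : Admissible A) (hp : 1 ≤ p) (hz : z ∈ siegelSet A) :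
    ‖fMin A p z‖ ≤ m * ‖z‖ := by
  have hp0 : 0 < p := one_pos.trans_le hp
  obtain ⟨i, -⟩ := nonempty_of_zero_mem_convOn hz
  have hm : (1 : ℝ) ≤ m := by exact_mod_cast Nat.succ_le_of_lt i.pos
  calc ‖fMin A p z‖ ≤ pNorm p (fMin A p z) := norm_le_pNorm hp0 _
    _ ≤ pNorm p z := (hA.isLeafMin_fMin hp0 hz).2 z (mem_leaf A z)
    _ ≤ (m : ℝ) ^ p⁻¹ * ‖z‖ := pNorm_le hp0 z
    _ ≤ m * ‖z‖ := by
      gcongr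
      exact Real.rpow_le_self_of_one_le hm (inv_le_one_of_one_le₀ hp)

/-! ### The limit `p → ∞` -/

/-- Parameters `T_n` of critical points for exponents `p_n → ∞` subconverge to a point whose
coordinates of greatest modulus satisfy `0 ∈ conv A(I)`. The critical point equation writes `0` as
the convex combination of the `A_i` with weights proportional to `|F(z, T_n)_i| ^ p_n`; in a limit
of these weights only the coordinates of greatest modulus survive. -/
theorem Admissible.exists_subseq_tendsto (hA : Admissible A) (hz : z ∈ siegelSet A) {p : ℕ → ℝ}
    (hp : ∀ n, 0 < p n) (hlim : Tendsto p atTop atTop) {T : ℕ → EuclideanSpace ℝ (Fin d)} {C : ℝ}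
    (hC : ∀ n, ‖flow A z (T n)‖ ≤ C)
    (hcrit : ∀ n, ∑ i, ‖flow A z (T n) i‖ ^ p n • A i = 0) :
    ∃ S, (0 : EuclideanSpace ℝ (Fin d)) ∈ convOn A (maxIndices (flow A z S)) ∧
      ∃ φ : ℕ → ℕ, StrictMono φ ∧ Tendsto (T ∘ φ) atTop (𝓝 S) := by
  set s : ℕ → ℝ := fun n => ∑ i, ‖flow A z (T n) i‖ ^ p n with hs
  set c : ℕ → Fin m → ℝ := fun n i => ‖flow A z (T n) i‖ ^ p n / s n with hc
  have hle (n : ℕ) : ‖flow A z (T n)‖ ^ p n ≤ s n := norm_rpow_le_sum (hp n) _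
  have hpow (n : ℕ) : 0 < ‖flow A z (T n)‖ ^ p n := Real.rpow_pos_of_pos (norm_flow_pos hz _) _
  have hspos (n : ℕ) : 0 < s n := (hpow n).trans_le (hle n)
  have hcmem (n : ℕ) : c n ∈ stdSimplex ℝ (Fin m) := by
    refine ⟨fun i => div_nonneg (Real.rpow_nonneg (norm_nonneg _) _) (hspos n).le, ?_⟩
    rw [← Finset.sum_div]
    exact div_self (hspos n).ne'
  have hc0 (n : ℕ) : ∑ i, c n i • A i = 0 := by
    simp only [hc, div_eq_inv_mul, mul_smul]
    rw [← Finset.smul_sum, hcrit, smul_zero]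
  obtain ⟨⟨S, b⟩, ⟨-, hb⟩, φ, hφ, hconv⟩ :=
    ((hA.isCompact_norm_flow_le hz C).prod (isCompact_stdSimplex ℝ (Fin m))).tendsto_subseq
      (x := fun n => (T n, c n)) fun n => ⟨hC n, hcmem n⟩
  have hT : Tendsto (T ∘ φ) atTop (𝓝 S) := (continuous_fst.tendsto _).comp hconv
  have hcb : Tendsto (c ∘ φ) atTop (𝓝 b) := (continuous_snd.tendsto _).comp hconv
  refine ⟨S, zero_mem_convOn_of_sum (c := b) hb.1 hb.2 ?_ ?_, φ, hφ, hT⟩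
  · have hcont : Continuous fun a : Fin m → ℝ => ∑ i, a i • A i := by fun_prop
    refine tendsto_nhds_unique ((hcont.tendsto b).comp hcb) ?_
    refine tendsto_const_nhds.congr fun n => ?_
    exact (hc0 (φ n)).symm
  · intro i hi
    have hlt : ‖flow A z S i‖ < ‖flow A z S‖ :=
      lt_of_le_of_ne (norm_le_pi_norm _ i) fun h => hi (by simp [maxIndices, h])
    have hpos := norm_flow_pos hz S
    obtain ⟨q, hq, hq1⟩ := exists_between ((div_lt_one hpos).2 hlt)
    have hq0 : 0 < q := (by positivity : 0 ≤ ‖flow A z S i‖ / ‖flow A z S‖).trans_lt hq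
    have hratio : Tendsto (fun n => ‖flow A z (T (φ n)) i‖ / ‖flow A z (T (φ n))‖) atTop
        (𝓝 (‖flow A z S i‖ / ‖flow A z S‖)) := by
      have hcont : Continuous fun T => ‖flow A z T i‖ / ‖flow A z T‖ :=
        ((continuous_apply i).comp (continuous_flow A z)).norm.div (continuous_flow A z).norm
          fun T => (norm_flow_pos hz T).ne'
      exact (hcont.tendsto S).comp hT
    have hzero : Tendsto (fun n => q ^ p (φ n)) atTop (𝓝 0) :=
      (tendsto_rpow_atTop_of_base_lt_one q (by linarith) hq1).comp (hlim.comp hφ.tendsto_atTop)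
    refine tendsto_nhds_unique (((continuous_apply i).tendsto b).comp hcb) ?_
    refine squeeze_zero' (Eventually.of_forall fun n => (hcmem (φ n)).1 i) ?_ hzero
    filter_upwards [hratio.eventually_lt_const hq] with n hn
    calc c (φ n) i
        ≤ ‖flow A z (T (φ n)) i‖ ^ p (φ n) / ‖flow A z (T (φ n))‖ ^ p (φ n) :=
          div_le_div_of_nonneg_left (Real.rpow_nonneg (norm_nonneg _) _) (hpow _) (hle _)
      _ = (‖flow A z (T (φ n)) i‖ / ‖flow A z (T (φ n))‖) ^ p (φ n) :=
          (Real.div_rpow (norm_nonneg _) (norm_nonneg _) _).symm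
      _ ≤ q ^ p (φ n) := Real.rpow_le_rpow (by positivity) hn.le (hp _).le

theorem Admissible.exists_subseq_tendsto_TMin (hA : Admissible A) (hz : z ∈ siegelSet A)
    {p : ℕ → ℝ} (hp : ∀ n, 1 ≤ p n) (hlim : Tendsto p atTop atTop) :
    ∃ S, (0 : EuclideanSpace ℝ (Fin d)) ∈ convOn A (maxIndices (flow A z S)) ∧
      ∃ φ : ℕ → ℕ, StrictMono φ ∧ Tendsto (fun n => TMin A (p (φ n)) z) atTop (𝓝 S) := by
  have hp0 (n : ℕ) : 0 < p n := one_pos.trans_le (hp n)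
  refine hA.exists_subseq_tendsto hz hp0 hlim (T := fun n => TMin A (p n) z) (C := m * ‖z‖)
    (fun n => ?_) fun n => ?_
  · rw [← hA.fMin_eq_flow (hp0 n) hz]
    exact hA.norm_fMin_le (hp n) hz
  · rw [← hA.fMin_eq_flow (hp0 n) hz]
    exact (hA.isLeafMin_fMin (hp0 n) hz).sum_rpow_smul_eq_zero (hp0 n)

/-! ### The point of the leaf over the moment-angle complex -/

theorem Admissible.existsUnique_isLeafInfty (hA : Admissible A) (hz : z ∈ siegelSet A) :
    ∃! w, IsLeafInfty A z w := by
  obtain ⟨S, hS, -⟩ := hA.exists_subseq_tendsto_TMin hz (p := fun n : ℕ => (n : ℝ) + 1)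
    (fun n => by simp) (tendsto_atTop_add_const_right _ _ tendsto_natCast_atTop_atTop)
  have hne (T) : flow A z T ≠ 0 := norm_pos_iff.1 (norm_flow_pos hz T)
  refine ⟨flow A z S, ⟨⟨S, rfl⟩, (inv_norm_smul_mem_momentAngle_iff (hne S)).2 hS⟩, ?_⟩
  rintro _ ⟨⟨T, rfl⟩, hT⟩
  rw [hA.eq_of_zero_mem_convOn_maxIndices hz
    ((inv_norm_smul_mem_momentAngle_iff (hne T)).1 hT) hS]

theorem Admissible.isLeafInfty_fInfty (hA : Admissible A) (hz : z ∈ siegelSet A) :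
    IsLeafInfty A z (fInfty A z) :=
  Classical.epsilon_spec (hA.existsUnique_isLeafInfty hz).exists

theorem norm_smul_of_mem_momentAngle {x : Fin m → ℂ} (hx : x ∈ momentAngle A) {r : ℝ}
    (hr : 0 < r) : ‖r • x‖ = r := by
  rw [norm_smul, norm_eq_one_of_mem_momentAngle hx, mul_one, Real.norm_of_nonneg hr.le]

theorem inv_norm_smul_smul_of_mem_momentAngle {x : Fin m → ℂ} (hx : x ∈ momentAngle A) {r : ℝ}
    (hr : 0 < r) : ‖r • x‖⁻¹ • r • x = x := by
  rw [norm_smul_of_mem_momentAngle hx hr, inv_smul_smul₀ hr.ne']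

/-- For `q = (x, T, r)`, the point `r x` lies in the leaf of `r F(x, T)`, with parameter `-T`. -/
theorem isLeafInfty_smul {q : (Fin m → ℂ) × EuclideanSpace ℝ (Fin d) × ℝ}
    (hq : q ∈ phiInftyDomain A) :
    flow A (Phi A q) (-q.2.1) = q.2.2 • q.1 ∧ IsLeafInfty A (Phi A q) (q.2.2 • q.1) := by
  have h : flow A (Phi A q) (-q.2.1) = q.2.2 • q.1 := by
    simp only [Phi, flow_smul, flow_flow, add_neg_cancel, flow_zero]
  exact ⟨h, ⟨_, h⟩, by rw [inv_norm_smul_smul_of_mem_momentAngle hq.1 hq.2.2]; exact hq.1⟩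

theorem Admissible.bijOn_Phi (hA : Admissible A) :
    BijOn (Phi A) (phiInftyDomain A) (siegelSet A) := by
  have hmaps : MapsTo (Phi A) (phiInftyDomain A) (siegelSet A) := by
    rintro ⟨x, T, r⟩ ⟨hx, -, hr⟩
    have hx' : (0 : EuclideanSpace ℝ (Fin d)) ∈ convOn A (supp x) :=
      momentAngle_subset_siegelSet hx
    rwa [siegelSet, mem_ofPred_eq, Phi, supp_smul (ne_of_gt hr), supp_flow]
  refine ⟨hmaps, ?_, ?_⟩
  · intro q hq q' hq' heq
    have hz := hmaps hq
    obtain ⟨h1, h2⟩ := isLeafInfty_smul hq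
    obtain ⟨h1', h2'⟩ := isLeafInfty_smul hq'
    rw [← heq] at h1' h2'
    have hw : q.2.2 • q.1 = q'.2.2 • q'.1 := (hA.existsUnique_isLeafInfty hz).unique h2 h2'
    have hT : -q.2.1 = -q'.2.1 := hA.flow_injective hz (h1.trans (hw.trans h1'.symm))
    have hr : q.2.2 = q'.2.2 := by
      rw [← norm_smul_of_mem_momentAngle hq.1 hq.2.2, hw,
        norm_smul_of_mem_momentAngle hq'.1 hq'.2.2]
    have hx : q.1 = q'.1 := by
      rw [← inv_norm_smul_smul_of_mem_momentAngle hq.1 hq.2.2, hw,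
        inv_norm_smul_smul_of_mem_momentAngle hq'.1 hq'.2.2]
    exact Prod.ext hx (Prod.ext (neg_injective hT) hr)
  · intro z hz
    obtain ⟨⟨T, hT⟩, hmem⟩ := hA.isLeafInfty_fInfty hz
    have hpos := norm_flow_pos hz T
    rw [← hT] at hmem
    refine ⟨(‖flow A z T‖⁻¹ • flow A z T, -T, ‖flow A z T‖), ⟨hmem, mem_univ _, hpos⟩, ?_⟩
    simp only [Phi, flow_smul, flow_flow, add_neg_cancel, flow_zero]
    exact smul_inv_smul₀ hpos.ne' z

theorem Admissible.fInfty_eq_flow (hA : Admissible A) (hz : z ∈ siegelSet A) :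
    fInfty A z = flow A z (TInfty A z) := by
  have hex : z ∈ Phi A '' phiInftyDomain A := hA.bijOn_Phi.surjOn hz
  have hval : Phi A (phiInftyInv A z) = z := Function.invFunOn_eq hex
  obtain ⟨h1, h2⟩ := isLeafInfty_smul (q := phiInftyInv A z) (Function.invFunOn_mem hex)
  rw [hval] at h1 h2
  exact ((hA.existsUnique_isLeafInfty hz).unique (hA.isLeafInfty_fInfty hz) h2).trans h1.symm

theorem Admissible.zero_mem_convOn_maxIndices_TInfty (hA : Admissible A) (hz : z ∈ siegelSet A) :
    (0 : EuclideanSpace ℝ (Fin d)) ∈ convOn A (maxIndices (flow A z (TInfty A z))) := by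
  rw [← inv_norm_smul_mem_momentAngle_iff (norm_pos_iff.1 (norm_flow_pos hz _)),
    ← hA.fInfty_eq_flow hz]
  exact (hA.isLeafInfty_fInfty hz).2

theorem Admissible.mem_momentAngle_and_mem_leaf_iff (hA : Admissible A) (hz : z ∈ siegelSet A)
    (y : Fin m → ℂ) :
    (y ∈ momentAngle A ∧ ∃ r : ℝ, 0 < r ∧ ∃ w ∈ leaf A z, y = r • w) ↔
      y = ‖fInfty A z‖⁻¹ • fInfty A z := by
  have hf := hA.isLeafInfty_fInfty hz
  constructor
  · rintro ⟨hy, r, hr, w, hw, rfl⟩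
    have hnorm : ‖w‖⁻¹ = r := by
      have := norm_eq_one_of_mem_momentAngle hy
      rw [norm_smul, Real.norm_of_nonneg hr.le] at this
      exact inv_eq_of_mul_eq_one_left this
    rw [← (hA.existsUnique_isLeafInfty hz).unique ⟨hw, hnorm.symm ▸ hy⟩ hf, hnorm]
  · rintro rfl
    refine ⟨hf.2, ‖fInfty A z‖⁻¹, ?_, _, hf.1, rfl⟩
    rw [hA.fInfty_eq_flow hz]
    exact inv_pos.2 (norm_flow_pos hz _)

theorem Admissible.tendsto_TMin (hA : Admissible A) (hz : z ∈ siegelSet A) :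
    Tendsto (fun p : ℝ => TMin A p z) atTop (𝓝 (TInfty A z)) := by
  refine tendsto_of_subseq_tendsto fun ns hns => ?_
  obtain ⟨N, hN⟩ := eventually_atTop.1 (hns.eventually_ge_atTop 1)
  obtain ⟨S, hS, φ, -, hconv⟩ := hA.exists_subseq_tendsto_TMin hz (p := fun n => ns (n + N))
    (fun n => hN _ (Nat.le_add_left N n)) (hns.comp (tendsto_add_atTop_nat N))
  rw [hA.eq_of_zero_mem_convOn_maxIndices hz hS
    (hA.zero_mem_convOn_maxIndices_TInfty hz)] at hconv
  exact ⟨fun n => φ n + N, hconv⟩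

theorem Admissible.tendsto_fMin (hA : Admissible A) (hz : z ∈ siegelSet A) :
    Tendsto (fun p : ℝ => fMin A p z) atTop (𝓝 (fInfty A z)) := by
  rw [hA.fInfty_eq_flow hz]
  refine (((continuous_flow A z).tendsto _).comp (hA.tendsto_TMin hz)).congr' ?_
  filter_upwards [eventually_gt_atTop 0] with p hp
  exact (hA.fMin_eq_flow hp hz).symm

/-- The least `L^p`-norm converges since `‖w‖_∞ ≤ ‖w‖_p ≤ m ^ (1 / p) ‖w‖_∞`. -/
theorem Admissible.tendsto_pNorm_fMin (hA : Admissible A) (hz : z ∈ siegelSet A) :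
    Tendsto (fun p : ℝ => pNorm p (fMin A p z)) atTop (𝓝 ‖fInfty A z‖) := by
  obtain ⟨i, -⟩ := nonempty_of_zero_mem_convOn hz
  have hm : (m : ℝ) ≠ 0 := by exact_mod_cast i.pos.ne'
  have hroot : Tendsto (fun p : ℝ => (m : ℝ) ^ p⁻¹) atTop (𝓝 1) := by
    have := (Real.continuousAt_const_rpow (b := 0) hm).tendsto.comp
      (tendsto_inv_atTop_zero (𝕜 := ℝ))
    rwa [Real.rpow_zero] at this
  have hnorm := (hA.tendsto_fMin hz).norm
  have hupper := hroot.mul hnorm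
  rw [one_mul] at hupper
  refine tendsto_of_tendsto_of_tendsto_of_le_of_le' hnorm hupper ?_ ?_
  · filter_upwards [eventually_gt_atTop 0] with p hp using norm_le_pNorm hp _
  · filter_upwards [eventually_gt_atTop 0] with p hp using pNorm_le hp _

end SiegelLeaves

open SiegelLeaves in
theorem mainTheorem5 {d m : ℕ} (A : Config d m) (hA : Admissible A) (hc : CenteredAtOrigin A)
    (z : Fin m → ℂ) (hz : z ∈ siegelSet A) :
    -- `f_p(z)` and `T_p(z)` are well defined
    (∀ p : ℝ, 1 ≤ p →
      (∃! w, IsLeafMin A p z w) ∧ 0 < pNorm p (fMin A p z) ∧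
      (∃! T, fMin A p z = flow A z T)) ∧
    -- `Φ_A(∞)` is a bijection, so that `T_∞` is well defined
    BijOn (Phi A) (phiInftyDomain A) (siegelSet A) ∧
    -- `f_∞(z)` is well defined, and it is reached from `z` by `T_∞(z)`
    (∃! w, IsLeafInfty A z w) ∧ fInfty A z = flow A z (TInfty A z) ∧
    -- `f_∞(z) / ‖f_∞(z)‖_∞` is the only positive multiple of a point of the leaf in the complex
    (∀ y : Fin m → ℂ, (y ∈ momentAngle A ∧ ∃ r : ℝ, 0 < r ∧ ∃ w ∈ leaf A z, y = r • w) ↔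
      y = ‖fInfty A z‖⁻¹ • fInfty A z) ∧
    -- the two limits
    Tendsto (fun p : ℝ => TMin A p z) atTop (𝓝 (TInfty A z)) ∧
    Tendsto (fun p : ℝ => (pNorm p (fMin A p z))⁻¹ • fMin A p z) atTop
      (𝓝 (‖fInfty A z‖⁻¹ • fInfty A z)) := by
  refine ⟨fun p hp => ?_, hA.bijOn_Phi, hA.existsUnique_isLeafInfty hz, hA.fInfty_eq_flow hz,
    hA.mem_momentAngle_and_mem_leaf_iff hz, hA.tendsto_TMin hz, ?_⟩
  · have hp0 : 0 < p := one_pos.trans_le hp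
    refine ⟨hA.existsUnique_isLeafMin hp0 hz, hA.pNorm_fMin_pos hp0 hz, TMin A p z,
      hA.fMin_eq_flow hp0 hz, fun T hT => ?_⟩
    exact hA.flow_injective hz (hT.symm.trans (hA.fMin_eq_flow hp0 hz))
  · have hne : ‖fInfty A z‖ ≠ 0 := by
      rw [hA.fInfty_eq_flow hz]
      exact (norm_flow_pos hz _).ne'
    exact ((hA.tendsto_pNorm_fMin hz).inv₀ hne).smul (hA.tendsto_fMin hz)
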